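/- Let $c,r,\mu,\sigma,\sigma_1,\lambda,m,A>0$ and $\rho\in(-1,1)$. For a $C^2$ function $W$ on $[0,\infty)$ (one-sided derivatives at $0$), $a\in\mathbb R$ and $x\ge 0$ put $$\mathcal L^{(a)}W(x)=\tfrac12(\sigma^2a^2+2\rho\sigma\sigma_1a+\sigma_1^2)W''(x)+[c+(\mu-r)a+rx]W'(x)-\lambda\Big[W(x)-\int_0^xW(x-s)\,dF(s)\Big],$$ where $F$ is the exponential distribution with mean $m$ (the claim size distribution). Let $V$ be a $C^2$ solution on $[0,\infty)$ of the Hamilton–Jacobi–Bellman equation $\sup_{0\le a\le A}\mathcal L^{(a)}V(x)=0$, $x\ge0$, with $V(0)=0$ and $V'(0+)=1$. Define $a_V(x)=-\frac{(\mu-r)V'(x)}{\sigma^2V''(x)}-\rho\frac{\sigma_1}{\sigma}$ where $V''(x)\neq0$, and let the optimal investment $a^*_V(x)$ be: if $V''(x)<0$, the projection of $a_V(x)$ onto $[0,A]$; if $V''(x)>0$, the value $0$ when $a_V(x)\ge A/2$ and $A$ when $a_V(x)<A/2$; if $V''(x)=0$, the value $A$. Put $q=\frac{(\mu-r)m}{\sigma^2}-\rho\frac{\sigma_1}{\sigma}$.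 Then for all sufficiently large $x$, $a_V^*(x)$ is the unique maximizer of $a\mapsto\mathcal L^{(a)}V(x)$ on $[0,A]$, and: - if $0\le q\le A$, then $a^*_V(x)=q+O(1/x)$ as $x\to\infty$; - if $q<0$, then $a^*_V(x)=0$ for all sufficiently large $x$; - if $q>A$, then $a^*_V(x)=A$ for all sufficiently large $x$; - if $0<q<A$, then moreover $$a^*_V(x)=q-\Big(1-\frac{\lambda}{r}\Big)\frac{(\mu-r)m^2}{\sigma^2}\,\frac1x+o\Big(\frac1x\Big),\qquad x\to\infty.$$ -/

import Mathlib

open Set Filter Topology MeasureTheory ProbabilityTheory Asymptotics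

noncomputable section

/-- Parameters of the perturbed Cramér–Lundberg model with investment, with the standing
assumptions: `c` premium rate, `r` interest rate, `μ`, `σ` return and volatility of the stock,
`σ₁` volatility of the Brownian perturbation, `ρ` the correlation of the two Brownian motions,
`lam` the claim intensity, `A` the upper bound for the amount invested in the stock. -/
structure RiskModel where
  c : ℝ
  r : ℝ
  μ : ℝ
  σ : ℝ
  σ₁ : ℝ
  ρ : ℝ
  lam : ℝ
  A : ℝ
  c_pos : 0 < c
  r_pos : 0 < r
  μ_pos : 0 < μ
  σ_pos : 0 < σ
  σ₁_pos : 0 < σ₁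
  abs_ρ_lt_one : |ρ| < 1
  lam_pos : 0 < lam
  A_pos : 0 < A

/-- First derivative on `[0,∞)` (one-sided at `0`). -/
def D1 (W : ℝ → ℝ) : ℝ → ℝ := derivWithin W (Ici 0)

/-- Second derivative on `[0,∞)` (one-sided at `0`). -/
def D2 (W : ℝ → ℝ) : ℝ → ℝ := derivWithin (derivWithin W (Ici 0)) (Ici 0)

namespace RiskModel

/-- `M(W)(x) = λ [W(x) - ∫₀ˣ W(x - s) dF(s)]`, where `F` is the law of the claims. -/
def M (P : RiskModel) (F : Measure ℝ) (W : ℝ → ℝ) (x : ℝ) : ℝ :=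
  P.lam * (W x - ∫ s in Icc 0 x, W (x - s) ∂F)

/-- The generator `𝓛^{(a)} W (x)` of the surplus when the amount `a` is held in the stock. -/
def gen (P : RiskModel) (F : Measure ℝ) (a : ℝ) (W : ℝ → ℝ) (x : ℝ) : ℝ :=
  1 / 2 * (P.σ ^ 2 * a ^ 2 + 2 * P.ρ * P.σ * P.σ₁ * a + P.σ₁ ^ 2) * D2 W x
    + (P.c + (P.μ - P.r) * a + P.r * x) * D1 W x - P.M F W x

/-- `V` is a classical solution on `[0,∞)` of the Hamilton–Jacobi–Bellman equation
`sup_{0 ≤ a ≤ A} 𝓛^{(a)} V (x) = 0`, normalized by `V(0) = 0`, `V'(0+) = 1`. -/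
structure IsHJBSolution (P : RiskModel) (F : Measure ℝ) (V : ℝ → ℝ) : Prop where
  contDiffOn : ContDiffOn ℝ 2 V (Ici 0)
  zero : V 0 = 0
  deriv_zero : D1 V 0 = 1
  hjb : ∀ x, 0 ≤ x → IsLUB ((fun a => P.gen F a V x) '' Icc 0 P.A) 0

/-- The unconstrained critical point `a_W(x)` of `a ↦ 𝓛^{(a)} W (x)` (for `W''(x) ≠ 0`). -/
def aCrit (P : RiskModel) (W : ℝ → ℝ) (x : ℝ) : ℝ :=
  -((P.μ - P.r) * D1 W x) / (P.σ ^ 2 * D2 W x) - P.ρ * (P.σ₁ / P.σ)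

open Classical in
/-- The optimal investment `a*_W(x)` under the constraint `0 ≤ a ≤ A`. -/
def aStar (P : RiskModel) (W : ℝ → ℝ) (x : ℝ) : ℝ :=
  if D2 W x < 0 then
    if P.aCrit W x ≤ 0 then 0
    else if P.A ≤ P.aCrit W x then P.A
    else P.aCrit W x
  else if 0 < D2 W x then
    if P.A / 2 ≤ P.aCrit W x then 0 else P.A
  else P.A

/-- `q = (μ - r) m / σ² - ρ σ₁ / σ`. -/
def q (P : RiskModel) (m : ℝ) : ℝ :=
  (P.μ - P.r) * m / P.σ ^ 2 - P.ρ * (P.σ₁ / P.σ)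

end RiskModel

end

/-- If `y` decreases at a definite rate whenever it is above the level `B`, then it is eventually
below `B`. -/
theorem eventually_le_of_deriv_le_neg {y y' : ℝ → ℝ} {B η : ℝ} (hη : 0 < η)
    (hd : ∀ᶠ x in atTop, HasDerivAt y (y' x) x)
    (hb : ∀ᶠ x in atTop, B ≤ y x → y' x ≤ -η) : ∀ᶠ x in atTop, y x ≤ B := by
  obtain ⟨x₀, h₀⟩ := eventually_atTop.1 (hd.and hb)
  have hc : ContinuousOn y (Ici x₀) := fun x hx => (h₀ x hx).1.continuousAt.continuousWithinAt
  obtain ⟨x₁, hx₁, hy₁⟩ : ∃ x₁ ≥ x₀, y x₁ ≤ B := by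
    by_contra! hcon
    set T := x₀ + (y x₀ - B) / η with hT
    have hpos : 0 ≤ (y x₀ - B) / η := div_nonneg (by linarith [hcon x₀ le_rfl]) hη.le
    have hx0T : x₀ ≤ T := by linarith
    have key := image_le_of_deriv_right_le_deriv_boundary (f := y) (f' := y') (a := x₀) (b := T)
      (B := fun x => y x₀ - η * (x - x₀)) (B' := fun _ => -η)
      (hc.mono Icc_subset_Ici_self) (fun x hx => (h₀ x hx.1).1.hasDerivWithinAt) (by simp)
      (by fun_prop)
      (fun x _ => by
        have := ((((hasDerivAt_id x).sub_const x₀).const_mul η).const_sub (y x₀))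
        simpa using this.hasDerivWithinAt)
      (fun x hx => (h₀ x hx.1).2 (hcon x hx.1).le) (right_mem_Icc.2 hx0T)
    have h2 : η * (T - x₀) = y x₀ - B := by
      rw [hT]; field_simp; ring
    have := hcon T hx0T
    linarith
  refine eventually_atTop.2 ⟨x₁, fun x hx => ?_⟩
  exact image_le_of_deriv_right_lt_deriv_boundary (f := y) (f' := y') (a := x₁) (b := x)
      (B := fun _ => B) (B' := fun _ => 0)
      (hc.mono fun z hz => hx₁.le.trans hz.1)
      (fun z hz => (h₀ z (hx₁.le.trans hz.1)).1.hasDerivWithinAt) hy₁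
      (fun z => hasDerivAt_const z B)
      (fun z hz he => by
        have := (h₀ z (hx₁.le.trans hz.1)).2 he.ge
        linarith) (right_mem_Icc.2 hx)

/-- The mirror image of `eventually_le_of_deriv_le_neg`. -/
theorem eventually_ge_of_le_deriv {y y' : ℝ → ℝ} {B η : ℝ} (hη : 0 < η)
    (hd : ∀ᶠ x in atTop, HasDerivAt y (y' x) x)
    (hb : ∀ᶠ x in atTop, y x ≤ B → η ≤ y' x) : ∀ᶠ x in atTop, B ≤ y x := by
  have := eventually_le_of_deriv_le_neg (y := fun x => -y x) (y' := fun x => -y' x) (B := -B) hη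
    (hd.mono fun x hx => hx.neg)
    (hb.mono fun x hx h => by linarith [hx (by linarith)])
  exact this.mono fun x hx => by linarith

/-- Asymptotics of the nonlinear equation `h' = 1 - h g`, where `g` is comparable to the
deviation `e = l h - r x - C` of `h` from the line `(r x + C) / l`. -/
theorem tendsto_mul_of_riccati {l r κ δ S L C : ℝ} (hl : 0 < l) (hr : 0 < r) (hδ : 0 < δ)
    (hκδ : δ ≤ κ) (hκS : κ ≤ S) {h g e q : ℝ → ℝ}
    (hh : ∀ x > 0, HasDerivAt h (1 - h x * g x) x) (hpos : ∀ x > 0, 0 < h x)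
    (he : ∀ x, e x = l * h x - r * x - C)
    (hlow : ∀ x > 0, κ * g x ≤ e x) (hup : ∀ x > 0, e x ≤ q x * g x)
    (hqδ : ∀ x > 0, δ ≤ q x) (hqS : ∀ x > 0, q x ≤ S) (hqκ : ∀ x > 0, |q x - κ| ≤ L * |g x|) :
    Tendsto (fun x => x * g x) atTop (𝓝 (l / r - 1)) := by
  have hκ : 0 < κ := hδ.trans_le hκδ
  have hS : 0 < S := hκ.trans_le hκS
  have ev0 : ∀ᶠ x : ℝ in atTop, 0 < x := eventually_gt_atTop 0
  -- sign and size of `g` against `e`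
  have hgpos : ∀ x > 0, 0 ≤ e x → e x ≤ S * g x ∧ 0 ≤ g x := by
    intro x hx hex
    have h1 := hup x hx
    have hg : 0 ≤ g x := by
      by_contra! hneg
      nlinarith [hqδ x hx]
    exact ⟨h1.trans (mul_le_mul_of_nonneg_right (hqS x hx) hg), hg⟩
  have hgneg : ∀ x > 0, e x ≤ 0 → S * g x ≤ e x ∧ g x ≤ 0 := by
    intro x hx hex
    have h1 := hlow x hx
    have hg : g x ≤ 0 := by
      by_contra! hneg
      nlinarith
    exact ⟨le_trans (mul_le_mul_of_nonpos_right hκS hg) h1, hg⟩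
  have hgabs : ∀ x > 0, δ * |g x| ≤ |e x| := by
    intro x hx
    rcases le_total 0 (g x) with hg | hg
    · rw [abs_of_nonneg hg]
      exact (mul_le_mul_of_nonneg_right hκδ hg).trans ((hlow x hx).trans (le_abs_self _))
    · rw [abs_of_nonpos hg]
      have := mul_le_mul_of_nonpos_right (hqδ x hx) hg
      have := neg_le_abs (e x)
      linarith [hup x hx]
  -- linear growth of `h`
  obtain ⟨η, hη, hgrow⟩ : ∃ η > 0, ∀ᶠ x in atTop, η * x ≤ l * h x := by
    set ε := min 1 (r / l) / 2 with hε
    have hm : 0 < min 1 (r / l) := lt_min one_pos (div_pos hr hl)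
    have hεpos : 0 < ε := by positivity
    have hε1 : ε ≤ 1 / 2 := by have := min_le_left 1 (r / l); linarith
    have hε2 : l * ε ≤ r := by
      have := min_le_right 1 (r / l)
      have h3 : ε ≤ r / l := by linarith
      calc l * ε ≤ l * (r / l) := by gcongr
        _ = r := by field_simp
    have := eventually_le_of_deriv_le_neg (y := fun x => ε * x - h x)
      (y' := fun x => ε * 1 - (1 - h x * g x)) (B := |C| / l) (η := 1 / 2) (by norm_num)
      (ev0.mono fun x hx => ((hasDerivAt_id x).const_mul ε).sub (hh x hx))
      (ev0.mono fun x hx hB => by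
        have h1 : |C| ≤ l * (ε * x - h x) := by
          rw [div_le_iff₀ hl] at hB; linarith
        have h2 : e x ≤ 0 := by
          rw [he]
          have := mul_le_mul_of_nonneg_right hε2 hx.le
          have := neg_abs_le C
          nlinarith
        have h3 := (hgneg x hx h2).2
        have h4 := mul_nonpos_of_nonneg_of_nonpos (hpos x hx).le h3
        linarith)
    refine ⟨l * ε / 2, by positivity, ?_⟩
    filter_upwards [this, eventually_ge_atTop (2 * (|C| / l) / ε)] with x hx hx2
    rw [div_le_iff₀ hεpos] at hx2
    have : l * (ε * x / 2) ≤ l * h x := by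
      apply mul_le_mul_of_nonneg_left _ hl.le
      linarith
    linarith
  have hey : ∀ x > 0, HasDerivAt (fun x => x * e x) (e x + x * (l - r - l * h x * g x)) x := by
    intro x hx
    have h1 : HasDerivAt e (l * (1 - h x * g x) - r * 1) x := by
      have := (((hh x hx).const_mul l).sub ((hasDerivAt_id x).const_mul r)).sub_const C
      have h2 : e = fun x => l * h x - r * x - C := funext he
      rw [h2]; exact this
    exact ((hasDerivAt_id x).mul h1).congr_deriv (by simp only [id]; ring)
  -- `x e` is bounded
  obtain ⟨B, hB, hbdd⟩ : ∃ B > 0, ∀ᶠ x in atTop, |x * e x| ≤ B := by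
    set B := (|l - r| + 1) * (2 * S / η) with hBdef
    have hBpos : 0 < B := by positivity
    have hBη : B * (η / (2 * S)) = |l - r| + 1 := by
      rw [hBdef]; field_simp
    have hx2 : ∀ᶠ x : ℝ in atTop, 1 / x ≤ η / (2 * S) * x ∧ 1 ≤ x := by
      filter_upwards [eventually_ge_atTop 1, eventually_ge_atTop (2 * S / η)] with x h1 h2
      refine ⟨?_, h1⟩
      have : 1 ≤ η / (2 * S) * x := by
        rw [div_le_iff₀ hη] at h2
        rw [div_mul_eq_mul_div, le_div_iff₀ (by positivity)]; linarith
      exact le_trans (by rw [div_le_one (by linarith)]; exact h1) this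
    have up := eventually_le_of_deriv_le_neg (y := fun x => x * e x) (B := B) one_pos
      (ev0.mono hey) (by
        filter_upwards [ev0, hgrow, hx2] with x hx hg1 ⟨hx2, hx3⟩ hB
        have he0 : 0 ≤ e x := by
          by_contra! hneg
          nlinarith
        obtain ⟨h1, h2⟩ := hgpos x hx he0
        have h3 : η * x * (e x / S) ≤ l * h x * g x := by
          apply mul_le_mul hg1 _ (by positivity) (mul_pos hl (hpos x hx)).le
          rw [div_le_iff₀ hS]; linarith
        have h4 : e x ≤ η / (2 * S) * x * (x * e x) := by
          calc e x = 1 / x * (x * e x) := by field_simp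
            _ ≤ _ := by gcongr
        have h5 : x * (η * x * (e x / S)) = 2 * (η / (2 * S) * x * (x * e x)) := by
          field_simp
        have h6 := mul_le_mul_of_nonneg_left h3 hx.le
        have h7 : (η / (2 * S) * x) * B ≤ (η / (2 * S) * x) * (x * e x) := by gcongr
        have h8 : (η / (2 * S) * x) * B = x * (|l - r| + 1) := by rw [← hBη]; ring
        have h9 := mul_le_mul_of_nonneg_left (le_abs_self (l - r)) hx.le
        nlinarith)
    have dn := eventually_ge_of_le_deriv (y := fun x => x * e x) (B := -B) one_pos
      (ev0.mono hey) (by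
        filter_upwards [ev0, hgrow, hx2] with x hx hg1 ⟨hx2, hx3⟩ hB
        have he0 : e x ≤ 0 := by
          by_contra! hneg
          nlinarith
        obtain ⟨h1, h2⟩ := hgneg x hx he0
        have h3 : η * x * (-e x / S) ≤ l * h x * (-g x) := by
          apply mul_le_mul hg1 _ (div_nonneg (by linarith) hS.le) (mul_pos hl (hpos x hx)).le
          rw [div_le_iff₀ hS]; linarith
        have hne : 0 ≤ x * (-e x) := mul_nonneg hx.le (by linarith)
        have h4 : -e x ≤ η / (2 * S) * x * (x * (-e x)) := by
          calc -e x = 1 / x * (x * (-e x)) := by field_simp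
            _ ≤ _ := by gcongr
        have h5 : x * (η * x * (-e x / S)) = 2 * (η / (2 * S) * x * (x * (-e x))) := by
          field_simp
        have h6 := mul_le_mul_of_nonneg_left h3 hx.le
        have hB' : B ≤ x * (-e x) := by linarith
        have h7 : (η / (2 * S) * x) * B ≤ (η / (2 * S) * x) * (x * (-e x)) := by gcongr
        have h8 : (η / (2 * S) * x) * B = x * (|l - r| + 1) := by rw [← hBη]; ring
        have h9 := mul_le_mul_of_nonneg_left (neg_abs_le (l - r)) hx.le
        nlinarith)
    refine ⟨B, hBpos, ?_⟩
    filter_upwards [up, dn] with x h1 h2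
    exact abs_le.2 ⟨h2, h1⟩
  have hgb : ∀ᶠ x in atTop, |x * g x| ≤ B / δ := by
    filter_upwards [hbdd, ev0] with x hx hx0
    rw [le_div_iff₀ hδ]
    rw [abs_mul, abs_of_pos hx0] at hx ⊢
    have := mul_le_mul_of_nonneg_left (hgabs x hx0) hx0.le
    linarith
  have hL : 0 ≤ |L| := abs_nonneg L
  -- linearization
  have hlin : ∀ᶠ x in atTop, |x ^ 2 * (e x - κ * g x)| ≤ |L| * (B / δ) ^ 2 := by
    filter_upwards [hgb, ev0] with x hx hx0
    have h1 : |e x - κ * g x| ≤ |L| * |g x| ^ 2 := by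
      rw [abs_of_nonneg (by linarith [hlow x hx0])]
      calc e x - κ * g x ≤ (q x - κ) * g x := by linarith [hup x hx0]
        _ ≤ |q x - κ| * |g x| := by rw [← abs_mul]; exact le_abs_self _
        _ ≤ (|L| * |g x|) * |g x| := by
            apply mul_le_mul_of_nonneg_right _ (abs_nonneg _)
            exact (hqκ x hx0).trans
              (mul_le_mul_of_nonneg_right (le_abs_self _) (abs_nonneg _))
        _ = _ := by ring
    rw [abs_mul, abs_of_pos (by positivity : (0:ℝ) < x ^ 2)]
    calc x ^ 2 * |e x - κ * g x| ≤ x ^ 2 * (|L| * |g x| ^ 2) := by gcongr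
      _ = |L| * (|x * g x|) ^ 2 := by rw [abs_mul, abs_of_pos hx0]; ring
      _ ≤ _ := by gcongr
  set D := B + r / κ * (|L| * (B / δ) ^ 2) + (|C| + B) * (B / δ) with hD
  have hrem : ∀ᶠ x in atTop, |(e x + x * (l - r - l * h x * g x))
      - x * (l - r - r / κ * (x * e x))| ≤ D := by
    filter_upwards [hbdd, hgb, hlin, eventually_ge_atTop 1] with x h1 h2 h3 hx
    have hx0 : 0 < x := by linarith
    have heB : |e x| ≤ B := by
      rw [abs_mul, abs_of_pos hx0] at h1
      nlinarith [abs_nonneg (e x)]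
    have hid : (e x + x * (l - r - l * h x * g x)) - x * (l - r - r / κ * (x * e x))
        = e x + r / κ * (x ^ 2 * (e x - κ * g x)) - (C + e x) * (x * g x) := by
      have : l * h x = e x + r * x + C := by rw [he]; ring
      rw [this]; field_simp; ring
    rw [hid]
    have a1 : |r / κ * (x ^ 2 * (e x - κ * g x))| ≤ r / κ * (|L| * (B / δ) ^ 2) := by
      rw [abs_mul, abs_of_pos (div_pos hr hκ)]; gcongr
    have a2 : |(C + e x) * (x * g x)| ≤ (|C| + B) * (B / δ) := by
      rw [abs_mul]
      apply mul_le_mul _ h2 (abs_nonneg _) (by positivity)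
      exact (abs_add_le _ _).trans (by linarith)
    calc _ ≤ |e x| + |r / κ * (x ^ 2 * (e x - κ * g x))| + |(C + e x) * (x * g x)| :=
          (abs_sub _ _).trans (by gcongr; exact abs_add_le _ _)
      _ ≤ D := by rw [hD]; gcongr
  have hye : Tendsto (fun x => x * e x) atTop (𝓝 (κ * (l / r - 1))) := by
    rw [Metric.tendsto_nhds]
    intro ε hε
    have hc : r / κ * (κ * (l / r - 1)) = l - r := by field_simp
    have hbig : ∀ᶠ x : ℝ in atTop, D + 1 ≤ x * (r / κ * (ε / 2)) :=
      (tendsto_id.atTop_mul_const (by positivity)).eventually_ge_atTop _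
    have up := eventually_le_of_deriv_le_neg (y := fun x => x * e x)
      (B := κ * (l / r - 1) + ε / 2) one_pos (ev0.mono hey) (by
        filter_upwards [ev0, hrem, hbig] with x hx h1 h2 h3
        have h4 := (abs_le.1 h1).2
        have h5 : r / κ * (κ * (l / r - 1) + ε / 2) ≤ r / κ * (x * e x) := by gcongr
        have h6 : x * (l - r - r / κ * (x * e x)) ≤ x * (-(r / κ * (ε / 2))) := by
          gcongr; linarith
        linarith)
    have dn := eventually_ge_of_le_deriv (y := fun x => x * e x)
      (B := κ * (l / r - 1) - ε / 2) one_pos (ev0.mono hey) (by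
        filter_upwards [ev0, hrem, hbig] with x hx h1 h2 h3
        have h4 := (abs_le.1 h1).1
        have h5 : r / κ * (x * e x) ≤ r / κ * (κ * (l / r - 1) - ε / 2) := by gcongr
        have h6 : x * (r / κ * (ε / 2)) ≤ x * (l - r - r / κ * (x * e x)) := by
          gcongr; linarith
        linarith)
    filter_upwards [up, dn] with x h1 h2
    rw [Real.dist_eq, abs_lt]
    constructor <;> linarith
  have hzero : Tendsto (fun x => x * (e x - κ * g x)) atTop (𝓝 0) := by
    have hz : Tendsto (fun x : ℝ => |L| * (B / δ) ^ 2 * x⁻¹) atTop (𝓝 0) := by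
      simpa using tendsto_inv_atTop_zero.const_mul (|L| * (B / δ) ^ 2)
    refine squeeze_zero_norm' ?_ hz
    filter_upwards [hlin, ev0] with x hx hx0
    rw [Real.norm_eq_abs, ← div_eq_mul_inv, le_div_iff₀ hx0]
    calc |x * (e x - κ * g x)| * x = |x ^ 2 * (e x - κ * g x)| := by
          rw [abs_mul, abs_mul, abs_of_pos hx0, abs_of_pos (by positivity : (0:ℝ) < x ^ 2)]; ring
      _ ≤ _ := hx
  have := (hye.sub hzero).div_const κ
  convert this using 2
  · field_simp; ring
  · field_simp; ring

/-- `V(x) - ∫₀ˣ V(x - s) dF(s)` for exponential claims of rate `k`. -/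
noncomputable def claimDrop (k : ℝ) (V : ℝ → ℝ) (x : ℝ) : ℝ :=
  V x - ∫ s in Icc 0 x, V (x - s) ∂(expMeasure k)

theorem setIntegral_expMeasure_sub {k : ℝ} (hk : 0 < k) (V : ℝ → ℝ) {x : ℝ} (hx : 0 ≤ x) :
    ∫ s in Icc 0 x, V (x - s) ∂(expMeasure k)
      = Real.exp (-(k * x)) * ∫ y in (0 : ℝ)..x, V (max y 0) * (k * Real.exp (k * y)) := by
  have h1 : ∫ s in Icc 0 x, V (x - s) ∂(expMeasure k)
      = ∫ s in Icc 0 x, (k * Real.exp (-(k * s))) * V (x - s) := by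
    have hmeas : Measurable (gammaPDF 1 k) := (measurable_gammaPDFReal 1 k).ennreal_ofReal
    rw [expMeasure, gammaMeasure, setIntegral_withDensity_eq_setIntegral_toReal_smul₀
      hmeas.aemeasurable
      (Eventually.of_forall fun _ => ENNReal.ofReal_lt_top) _ measurableSet_Icc]
    refine setIntegral_congr_fun measurableSet_Icc fun s hs => ?_
    have : gammaPDF 1 k s = ENNReal.ofReal (k * Real.exp (-(k * s))) :=
      exponentialPDF_of_nonneg hs.1
    rw [this, ENNReal.toReal_ofReal (by positivity), smul_eq_mul]
  rw [h1, integral_Icc_eq_integral_Ioc, ← intervalIntegral.integral_of_le hx]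
  have h2 := intervalIntegral.integral_comp_sub_left (a := 0) (b := x)
    (fun y => k * Real.exp (-(k * (x - y))) * V y) x
  simp only [sub_sub_cancel, sub_self, sub_zero] at h2
  rw [h2, ← intervalIntegral.integral_const_mul]
  refine intervalIntegral.integral_congr fun y hy => ?_
  rw [uIcc_of_le hx] at hy
  simp only [max_eq_left hy.1]
  rw [show -(k * (x - y)) = -(k * x) + k * y by ring, Real.exp_add]
  ring

theorem claimDrop_eq {k : ℝ} (hk : 0 < k) (V : ℝ → ℝ) {x : ℝ} (hx : 0 ≤ x) :
    claimDrop k V x = V x - Real.exp (-(k * x)) *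
      ∫ y in (0 : ℝ)..x, V (max y 0) * (k * Real.exp (k * y)) := by
  rw [claimDrop, setIntegral_expMeasure_sub hk V hx]

theorem continuous_comp_max_zero {V : ℝ → ℝ} (hV : ContinuousOn V (Ici 0)) :
    Continuous fun y => V (max y 0) :=
  hV.comp_continuous (by fun_prop) fun y => le_max_right y 0

theorem hasDerivAt_integral_max {k : ℝ} {V : ℝ → ℝ} (hV : ContinuousOn V (Ici 0)) (x : ℝ) :
    HasDerivAt (fun x => ∫ y in (0 : ℝ)..x, V (max y 0) * (k * Real.exp (k * y)))
      (V (max x 0) * (k * Real.exp (k * x))) x := by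
  have hc : Continuous fun y => V (max y 0) * (k * Real.exp (k * y)) :=
    (continuous_comp_max_zero hV).mul (by fun_prop)
  exact (hc.integral_hasStrictDerivAt 0 x).hasDerivAt

theorem continuousOn_claimDrop {k : ℝ} (hk : 0 < k) {V : ℝ → ℝ} (hV : ContinuousOn V (Ici 0)) :
    ContinuousOn (claimDrop k V) (Ici 0) := by
  refine ContinuousOn.congr (hV.sub (ContinuousOn.mul (by fun_prop) ?_))
    fun x hx => claimDrop_eq hk V hx
  exact fun x _ => (hasDerivAt_integral_max hV x).continuousAt.continuousWithinAt

theorem hasDerivAt_claimDrop {k : ℝ} (hk : 0 < k) {V : ℝ → ℝ} (hV : ContinuousOn V (Ici 0))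
    {x v : ℝ} (hx : 0 < x) (hv : HasDerivAt V v x) :
    HasDerivAt (claimDrop k V) (v - k * claimDrop k V x) x := by
  have hexp : HasDerivAt (fun x => Real.exp (-(k * x))) (Real.exp (-(k * x)) * (-(k * 1))) x :=
    (((hasDerivAt_id x).const_mul k).neg).exp
  have h := hv.sub (hexp.mul (hasDerivAt_integral_max (k := k) hV x))
  have heq : claimDrop k V =ᶠ[𝓝 x] fun x => V x - Real.exp (-(k * x)) *
      ∫ y in (0 : ℝ)..x, V (max y 0) * (k * Real.exp (k * y)) := by
    filter_upwards [lt_mem_nhds hx] with y hy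
    exact claimDrop_eq hk V hy.le
  refine HasDerivAt.congr_of_eventuallyEq ?_ heq
  refine h.congr_deriv ?_
  rw [claimDrop_eq hk V hx.le, max_eq_left hx.le]
  have : Real.exp (-(k * x)) * Real.exp (k * x) = 1 := by rw [← Real.exp_add]; simp
  linear_combination (-(V x) * k) * this

theorem claimDrop_zero {k : ℝ} (hk : 0 < k) {V : ℝ → ℝ} (h0 : V 0 = 0) : claimDrop k V 0 = 0 := by
  rw [claimDrop_eq hk V le_rfl]; simp [h0]

/-- If `V(0) = 0` and `V' > 0` on `(0, x)` then `V(x) > ∫₀ˣ V(x - s) dF(s)`. -/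
theorem claimDrop_pos {k : ℝ} (hk : 0 < k) {V v : ℝ → ℝ} (hV : ContinuousOn V (Ici 0))
    (h0 : V 0 = 0) (hd : ∀ x > 0, HasDerivAt V (v x) x) {x : ℝ} (hx : 0 < x)
    (hv : ∀ y ∈ Ioo 0 x, 0 < v y) : 0 < claimDrop k V x := by
  have hder : ∀ y > 0, HasDerivAt (fun y => claimDrop k V y * Real.exp (k * y))
      (v y * Real.exp (k * y)) y := by
    intro y hy
    have hexp : HasDerivAt (fun y => Real.exp (k * y)) (Real.exp (k * y) * (k * 1)) y :=
      ((hasDerivAt_id y).const_mul k).exp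
    exact ((hasDerivAt_claimDrop hk hV hy (hd y hy)).mul hexp).congr_deriv (by ring)
  have hmono : StrictMonoOn (fun y => claimDrop k V y * Real.exp (k * y)) (Icc 0 x) := by
    refine strictMonoOn_of_deriv_pos (convex_Icc 0 x) ?_ fun y hy => ?_
    · exact ((continuousOn_claimDrop hk hV).mono Icc_subset_Ici_self).mul (by fun_prop)
    · rw [interior_Icc] at hy
      rw [(hder y hy.1).deriv]
      exact mul_pos (hv y hy) (Real.exp_pos _)
  have := hmono (left_mem_Icc.2 hx.le) (right_mem_Icc.2 hx.le) hx
  simp only [claimDrop_zero hk h0, zero_mul] at this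
  exact pos_of_mul_pos_left this (Real.exp_pos _).le

namespace RiskModel

variable (P : RiskModel)

/-- Half the squared volatility of the surplus when the amount `a` is invested. -/
noncomputable def halfVar (a : ℝ) : ℝ :=
  1 / 2 * (P.σ ^ 2 * a ^ 2 + 2 * P.ρ * P.σ * P.σ₁ * a + P.σ₁ ^ 2)

theorem continuous_halfVar : Continuous P.halfVar := by
  unfold halfVar; fun_prop

theorem halfVar_pos (a : ℝ) : 0 < P.halfVar a := by
  have h1 : P.ρ ^ 2 < 1 := (sq_lt_one_iff_abs_lt_one _).2 P.abs_ρ_lt_one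
  have h2 := sq_pos_of_pos P.σ₁_pos
  have : P.halfVar a = 1 / 2 * ((P.σ * a + P.ρ * P.σ₁) ^ 2 + (1 - P.ρ ^ 2) * P.σ₁ ^ 2) := by
    unfold halfVar; ring
  rw [this]
  nlinarith [sq_nonneg (P.σ * a + P.ρ * P.σ₁), mul_pos (sub_pos.2 h1) h2]

theorem exists_halfVar_bounds : ∃ δ > 0, ∃ S, ∀ a ∈ Icc 0 P.A, δ ≤ P.halfVar a ∧ P.halfVar a ≤ S := by
  have hne : (Icc 0 P.A).Nonempty := nonempty_Icc.2 P.A_pos.le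
  obtain ⟨a, _, ha⟩ := isCompact_Icc.exists_isMinOn hne P.continuous_halfVar.continuousOn
  obtain ⟨b, _, hb⟩ := isCompact_Icc.exists_isMaxOn hne P.continuous_halfVar.continuousOn
  exact ⟨P.halfVar a, P.halfVar_pos a, P.halfVar b, fun y hy => ⟨ha hy, hb hy⟩⟩

theorem gen_eq (k a : ℝ) (V : ℝ → ℝ) (x : ℝ) :
    P.gen (expMeasure k) a V x = P.halfVar a * D2 V x
      + (P.c + (P.μ - P.r) * a + P.r * x) * D1 V x - P.lam * claimDrop k V x := rfl

variable {P}

namespace IsHJBSolution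

variable {F : Measure ℝ} {V : ℝ → ℝ}

theorem hasDerivAt (hV : P.IsHJBSolution F V) {x : ℝ} (hx : 0 < x) :
    HasDerivAt V (D1 V x) x := by
  have := (hV.contDiffOn.differentiableOn (by norm_num)) x hx.le
  exact this.hasDerivWithinAt.hasDerivAt (Ici_mem_nhds hx)

theorem contDiffOn_D1 (hV : P.IsHJBSolution F V) : ContDiffOn ℝ 1 (D1 V) (Ici 0) :=
  hV.contDiffOn.derivWithin (uniqueDiffOn_Ici 0) (by norm_num)

theorem hasDerivAt_D1 (hV : P.IsHJBSolution F V) {x : ℝ} (hx : 0 < x) :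
    HasDerivAt (D1 V) (D2 V x) x := by
  have := (hV.contDiffOn_D1.differentiableOn (by norm_num)) x hx.le
  exact this.hasDerivWithinAt.hasDerivAt (Ici_mem_nhds hx)

/-- The supremum in the Hamilton–Jacobi–Bellman equation is attained. -/
theorem exists_gen_eq_zero (hV : P.IsHJBSolution F V) {x : ℝ} (hx : 0 ≤ x) :
    ∃ a ∈ Icc 0 P.A, P.gen F a V x = 0 := by
  have hne : (Icc 0 P.A).Nonempty := nonempty_Icc.2 P.A_pos.le
  have hc : ContinuousOn (fun a => P.gen F a V x) (Icc 0 P.A) := by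
    unfold gen; fun_prop
  obtain ⟨a, ha, hmax⟩ := isCompact_Icc.exists_isMaxOn hne hc
  refine ⟨a, ha, le_antisymm ((hV.hjb x hx).1 (mem_image_of_mem _ ha)) ?_⟩
  refine (hV.hjb x hx).2 ?_
  rintro _ ⟨b, hb, rfl⟩
  exact hmax hb

theorem gen_le_zero (hV : P.IsHJBSolution F V) {x a : ℝ} (hx : 0 ≤ x) (ha : a ∈ Icc 0 P.A) :
    P.gen F a V x ≤ 0 :=
  (hV.hjb x hx).1 (mem_image_of_mem _ ha)

theorem D1_pos {k : ℝ} (hk : 0 < k) (hV : P.IsHJBSolution (expMeasure k) V) {x : ℝ}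
    (hx : 0 ≤ x) : 0 < D1 V x := by
  by_contra! hneg
  have hcont := hV.contDiffOn_D1.continuousOn
  set S := Icc 0 x ∩ D1 V ⁻¹' Iic 0 with hS
  have hSc : IsCompact S :=
    isCompact_Icc.of_isClosed_subset
      ((hcont.mono Icc_subset_Ici_self).preimage_isClosed_of_isClosed isClosed_Icc isClosed_Iic)
      inter_subset_left
  obtain ⟨z, ⟨⟨hz0, hzx⟩, hzv⟩, hzmin⟩ := hSc.exists_isLeast ⟨x, ⟨hx, le_rfl⟩, hneg⟩
  have hz : 0 < z := by
    rcases hz0.eq_or_lt with h | h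
    · rw [mem_preimage, ← h, hV.deriv_zero, mem_Iic] at hzv; linarith
    · exact h
  have hlt : ∀ y ∈ Ico 0 z, 0 < D1 V y := by
    intro y hy
    by_contra! hy'
    exact absurd (hzmin ⟨⟨hy.1, hy.2.le.trans hzx⟩, hy'⟩) (not_le.2 hy.2)
  have hd := hV.hasDerivAt_D1 hz
  have hz1 : D1 V z = 0 := by
    refine le_antisymm hzv ?_
    have ht : Tendsto (D1 V) (𝓝[<] z) (𝓝 (D1 V z)) := hd.continuousAt.tendsto.mono_left
      nhdsWithin_le_nhds
    refine ge_of_tendsto ht ?_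
    filter_upwards [Ico_mem_nhdsLT hz] with y hy using (hlt y hy).le
  have hG : 0 < claimDrop k V z := claimDrop_pos hk hV.contDiffOn.continuousOn hV.zero
    (fun y hy => hV.hasDerivAt hy) hz fun y hy => hlt y ⟨hy.1.le, hy.2⟩
  obtain ⟨a, ha, hgen⟩ := hV.exists_gen_eq_zero hz.le
  rw [gen_eq, hz1, mul_zero, add_zero] at hgen
  have hD2 : 0 < D2 V z := by
    have h1 := mul_pos P.lam_pos hG
    have h2 := P.halfVar_pos a
    by_contra! h3
    nlinarith
  have hle : D2 V z ≤ 0 := by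
    have ht : Tendsto (slope (D1 V) z) (𝓝[<] z) (𝓝 (D2 V z)) :=
      (hasDerivAt_iff_tendsto_slope.1 hd).mono_left (nhdsWithin_mono _ fun y hy => ne_of_lt hy)
    refine le_of_tendsto ht ?_
    filter_upwards [Ico_mem_nhdsLT hz] with y hy
    rw [slope_def_field, hz1, sub_zero]
    exact div_nonpos_of_nonneg_of_nonpos (hlt y hy).le (by linarith [hy.2])
  linarith

/-- The logarithmic derivative of `V'` is `-k + (λ / r - 1) / x + o(1 / x)`. -/
theorem tendsto_mul_logDeriv_add {k : ℝ} (hk : 0 < k) (hV : P.IsHJBSolution (expMeasure k) V) :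
    Tendsto (fun x => x * (D2 V x / D1 V x + k)) atTop (𝓝 (P.lam / P.r - 1)) := by
  have hpos : ∀ x > 0, 0 < D1 V x := fun x hx => hV.D1_pos hk (le_of_lt hx)
  have hVc := hV.contDiffOn.continuousOn
  obtain ⟨δ, hδ, S, hδS⟩ := P.exists_halfVar_bounds
  obtain ⟨b, hb, hmax⟩ := isCompact_Icc.exists_isMaxOn (nonempty_Icc.2 P.A_pos.le)
    (f := fun a => P.halfVar a * (-k) + (P.μ - P.r) * a)
    ((P.continuous_halfVar.mul continuous_const).add
      (continuous_const.mul continuous_id)).continuousOn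
  have hconc : ∀ a ∈ Icc 0 P.A, k * P.σ ^ 2 / 8 * (a - b) ^ 2 ≤
      (P.halfVar b * (-k) + (P.μ - P.r) * b) - (P.halfVar a * (-k) + (P.μ - P.r) * a) := by
    intro a ha
    have hmid : (a + b) / 2 ∈ Icc 0 P.A :=
      ⟨by linarith [ha.1, hb.1], by linarith [ha.2, hb.2]⟩
    have h1 := hmax hmid
    simp only [mem_ofPred_eq, halfVar] at h1 ⊢
    have h2 : 0 ≤ k * P.σ ^ 2 * (a - b) ^ 2 := by positivity
    nlinarith
  choose! α hα hαgen using fun x (hx : 0 ≤ x) => hV.exists_gen_eq_zero hx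
  set Lc := P.σ ^ 2 * P.A + |P.ρ * P.σ * P.σ₁| with hLc
  have hLip : ∀ a ∈ Icc 0 P.A, |P.halfVar a - P.halfVar b| ≤ Lc * |a - b| := by
    intro a ha
    have : P.halfVar a - P.halfVar b
        = (P.σ ^ 2 * ((a + b) / 2) + P.ρ * P.σ * P.σ₁) * (a - b) := by
      unfold halfVar; ring
    rw [this, abs_mul]
    gcongr
    refine (abs_add_le _ _).trans ?_
    rw [hLc, abs_mul, abs_of_nonneg (sq_nonneg P.σ),
      abs_of_nonneg (by linarith [ha.1, hb.1] : 0 ≤ (a + b) / 2)]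
    gcongr
    linarith [ha.2, hb.2]
  have hLc0 : 0 ≤ Lc := by
    have := P.A_pos
    positivity
  have hσ := P.σ_pos
  set K₀ := P.halfVar b * (-k) + (P.μ - P.r) * b with hK₀
  have heq : ∀ x > 0, P.lam * (claimDrop k V x / D1 V x) = P.halfVar (α x) * (D2 V x / D1 V x)
      + (P.c + (P.μ - P.r) * α x + P.r * x) := by
    intro x hx
    have h1 := hαgen x (le_of_lt hx)
    rw [gen_eq] at h1
    have := (hpos x hx).ne'
    field_simp
    linarith
  have hle : ∀ x > 0, ∀ a ∈ Icc 0 P.A, P.halfVar a * (D2 V x / D1 V x)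
      + (P.c + (P.μ - P.r) * a + P.r * x) ≤ P.lam * (claimDrop k V x / D1 V x) := by
    intro x hx a ha
    have h1 := hV.gen_le_zero (le_of_lt hx) ha
    rw [gen_eq] at h1
    have hp := hpos x hx
    rw [← mul_div_assoc, ← mul_div_assoc, le_div_iff₀ hp, add_mul, div_mul_cancel₀ _ hp.ne']
    linarith
  refine tendsto_mul_of_riccati (l := P.lam) (r := P.r) (κ := P.halfVar b) (δ := δ) (S := S)
    (L := Lc * (8 * Lc / (k * P.σ ^ 2))) (C := P.c + K₀)
    (h := fun x => claimDrop k V x / D1 V x) (q := fun x => P.halfVar (α x))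
    P.lam_pos P.r_pos hδ (hδS b hb).1 (hδS b hb).2 ?_ ?_ (fun x => rfl) ?_ ?_
    (fun x hx => (hδS _ (hα x (le_of_lt hx))).1) (fun x hx => (hδS _ (hα x (le_of_lt hx))).2) ?_
  · intro x hx
    have hp := (hpos x hx).ne'
    refine ((hasDerivAt_claimDrop hk hVc hx (hV.hasDerivAt hx)).div (hV.hasDerivAt_D1 hx)
      hp).congr_deriv ?_
    field_simp
    ring
  · exact fun x hx => div_pos (claimDrop_pos hk hVc hV.zero (fun y hy => hV.hasDerivAt hy) hx
      fun y hy => hpos y hy.1) (hpos x hx)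
  · intro x hx
    have := hle x hx b hb
    linarith
  · intro x hx
    have := heq x hx
    have := hmax (hα x (le_of_lt hx))
    simp only [mem_ofPred_eq] at this
    linarith
  · intro x hx
    have ha := hα x (le_of_lt hx)
    set g := D2 V x / D1 V x + k with hg
    have h1 := hconc _ ha
    have h2 := heq x hx
    have h3 := hle x hx b hb
    have h4 : k * P.σ ^ 2 / 8 * |α x - b| ^ 2 ≤ (Lc * |α x - b|) * |g| := by
      calc k * P.σ ^ 2 / 8 * |α x - b| ^ 2 ≤ (P.halfVar (α x) - P.halfVar b) * g := by
            rw [sq_abs, hg]; linarith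
        _ ≤ |P.halfVar (α x) - P.halfVar b| * |g| := by rw [← abs_mul]; exact le_abs_self _
        _ ≤ _ := mul_le_mul_of_nonneg_right (hLip _ ha) (abs_nonneg _)
    have h5 : |α x - b| ≤ 8 * Lc / (k * P.σ ^ 2) * |g| := by
      rcases (abs_nonneg (α x - b)).eq_or_lt with h | h
      · rw [← h]; positivity
      · rw [div_mul_eq_mul_div, le_div_iff₀ (by positivity)]
        have : |α x - b| * (k * P.σ ^ 2 / 8 * |α x - b|) ≤ |α x - b| * (Lc * |g|) := by
          linarith
        have := le_of_mul_le_mul_left this h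
        linarith
    calc |P.halfVar (α x) - P.halfVar b| ≤ Lc * |α x - b| := hLip _ ha
      _ ≤ Lc * (8 * Lc / (k * P.σ ^ 2) * |g|) := by gcongr
      _ = _ := by ring

end IsHJBSolution

end RiskModel

namespace RiskModel

variable {P : RiskModel} {V : ℝ → ℝ} {x : ℝ}

theorem aStar_mem (P : RiskModel) (V : ℝ → ℝ) (x : ℝ) : P.aStar V x ∈ Icc 0 P.A := by
  have := P.A_pos
  unfold aStar
  split_ifs <;> constructor <;> linarith

theorem aStar_eq_zero (h : D2 V x < 0) (h0 : P.aCrit V x ≤ 0) : P.aStar V x = 0 := by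
  rw [aStar, if_pos h, if_pos h0]

theorem aStar_eq_A (h : D2 V x < 0) (h0 : P.A ≤ P.aCrit V x) : P.aStar V x = P.A := by
  rw [aStar, if_pos h, if_neg (by linarith [P.A_pos]), if_pos h0]

theorem aStar_eq_aCrit (h : D2 V x < 0) (h0 : 0 < P.aCrit V x) (h1 : P.aCrit V x < P.A) :
    P.aStar V x = P.aCrit V x := by
  rw [aStar, if_pos h, if_neg h0.not_ge, if_neg h1.not_ge]

/-- `a*` is the metric projection of `a_V` to `[0, A]`. -/
theorem abs_aStar_sub_le (h : D2 V x < 0) {p : ℝ} (hp : p ∈ Icc 0 P.A) :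
    |P.aStar V x - p| ≤ |P.aCrit V x - p| := by
  rcases le_or_gt (P.aCrit V x) 0 with h0 | h0
  · rw [aStar_eq_zero h h0, abs_of_nonpos (by linarith [hp.1]),
      abs_of_nonpos (by linarith [hp.1])]
    linarith
  rcases le_or_gt P.A (P.aCrit V x) with h1 | h1
  · rw [aStar_eq_A h h1, abs_of_nonneg (by linarith [hp.2]), abs_of_nonneg (by linarith [hp.2])]
    linarith
  · rw [aStar_eq_aCrit h h0 h1]

theorem gen_sub_gen (F : Measure ℝ) (h : D2 V x ≠ 0) (a b : ℝ) :
    P.gen F b V x - P.gen F a V x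
      = P.σ ^ 2 * D2 V x / 2 * ((b - P.aCrit V x) ^ 2 - (a - P.aCrit V x) ^ 2) := by
  have := P.σ_pos.ne'
  unfold gen aCrit
  field_simp
  ring

theorem gen_lt_gen_aStar (F : Measure ℝ) (h : D2 V x < 0) {a : ℝ} (ha : a ∈ Icc 0 P.A)
    (hne : a ≠ P.aStar V x) : P.gen F a V x < P.gen F (P.aStar V x) V x := by
  rw [← sub_pos, gen_sub_gen F h.ne]
  refine mul_pos_of_neg_of_neg (by nlinarith [sq_pos_of_pos P.σ_pos]) (sub_neg.2 ?_)
  have hA := P.A_pos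
  rcases le_or_gt (P.aCrit V x) 0 with h0 | h0
  · rw [aStar_eq_zero h h0] at hne ⊢
    have := lt_of_le_of_ne ha.1 hne.symm
    nlinarith
  rcases le_or_gt P.A (P.aCrit V x) with h1 | h1
  · rw [aStar_eq_A h h1] at hne ⊢
    have := lt_of_le_of_ne ha.2 hne
    nlinarith
  · rw [aStar_eq_aCrit h h0 h1] at hne ⊢
    rw [sub_self, zero_pow two_ne_zero]
    exact sq_pos_of_ne_zero (sub_ne_zero.2 hne)

namespace IsHJBSolution

variable {m : ℝ}

theorem tendsto_logDeriv_add {k : ℝ} (hk : 0 < k) (hV : P.IsHJBSolution (expMeasure k) V) :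
    Tendsto (fun x => D2 V x / D1 V x + k) atTop (𝓝 0) := by
  have h := tendsto_inv_atTop_zero.mul (hV.tendsto_mul_logDeriv_add hk)
  rw [zero_mul] at h
  refine h.congr' ?_
  filter_upwards [eventually_gt_atTop 0] with x hx
  field_simp

theorem eventually_D2_neg {k : ℝ} (hk : 0 < k) (hV : P.IsHJBSolution (expMeasure k) V) :
    ∀ᶠ x in atTop, D2 V x < 0 := by
  filter_upwards [(hV.tendsto_logDeriv_add hk).eventually_lt_const hk, eventually_ge_atTop 0]
    with x h hx
  by_contra! hneg
  have := div_nonneg hneg (hV.D1_pos hk hx).le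
  linarith

theorem tendsto_mul_aCrit_sub (hm : 0 < m) (hV : P.IsHJBSolution (expMeasure m⁻¹) V) :
    Tendsto (fun x => x * (P.aCrit V x - P.q m)) atTop
      (𝓝 ((P.lam / P.r - 1) * ((P.μ - P.r) * m ^ 2 / P.σ ^ 2))) := by
  have hk : 0 < m⁻¹ := inv_pos.2 hm
  have hg := hV.tendsto_logDeriv_add hk
  have h2 : Tendsto (fun x => (P.μ - P.r) * m / P.σ ^ 2
      / (m⁻¹ - (D2 V x / D1 V x + m⁻¹))) atTop (𝓝 ((P.μ - P.r) * m / P.σ ^ 2 / (m⁻¹ - 0))) :=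
    tendsto_const_nhds.div (tendsto_const_nhds.sub hg) (by simpa using hm.ne')
  have h3 := (hV.tendsto_mul_logDeriv_add hk).mul h2
  have hlim : (P.μ - P.r) * m / P.σ ^ 2 / (m⁻¹ - 0) = (P.μ - P.r) * m ^ 2 / P.σ ^ 2 := by
    rw [sub_zero, div_inv_eq_mul]; ring
  rw [hlim] at h3
  refine h3.congr' ?_
  filter_upwards [hV.eventually_D2_neg hk, eventually_ge_atTop 0] with x hx hx0
  have hp := (hV.D1_pos hk hx0).ne'
  have hσ := P.σ_pos.ne'
  have hd := hx.ne
  unfold aCrit q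
  rw [show m⁻¹ - (D2 V x / D1 V x + m⁻¹) = -(D2 V x / D1 V x) by ring]
  field_simp
  ring

theorem aCrit_sub_isBigO (hm : 0 < m) (hV : P.IsHJBSolution (expMeasure m⁻¹) V) :
    (fun x => P.aCrit V x - P.q m) =O[atTop] fun x => 1 / x := by
  have h := ((hV.tendsto_mul_aCrit_sub hm).isBigO_one ℝ).mul (isBigO_refl (fun x => 1 / x) atTop)
  refine h.congr' ?_ (by simp)
  filter_upwards [eventually_gt_atTop 0] with x hx
  field_simp

theorem tendsto_aCrit (hm : 0 < m) (hV : P.IsHJBSolution (expMeasure m⁻¹) V) :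
    Tendsto (P.aCrit V) atTop (𝓝 (P.q m)) := by
  have h : Tendsto (fun x : ℝ => 1 / x) atTop (𝓝 0) := by simpa using tendsto_inv_atTop_zero (𝕜 := ℝ)
  simpa using ((hV.aCrit_sub_isBigO hm).trans_tendsto h).add_const (P.q m)

end IsHJBSolution

end RiskModel

theorem mainTheorem8 (P : RiskModel) (m : ℝ) (hm : 0 < m) (V : ℝ → ℝ)
    (hV : P.IsHJBSolution (expMeasure m⁻¹) V) :
    -- for large surplus, `a*_V(x)` is the unique maximizer in the HJB equation
    (∀ᶠ x in atTop, P.aStar V x ∈ Icc 0 P.A ∧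
      ∀ a ∈ Icc 0 P.A, a ≠ P.aStar V x →
        P.gen (expMeasure m⁻¹) a V x < P.gen (expMeasure m⁻¹) (P.aStar V x) V x) ∧
    (0 ≤ P.q m → P.q m ≤ P.A →
      (fun x => P.aStar V x - P.q m) =O[atTop] (fun x => 1 / x)) ∧
    (P.q m < 0 → ∀ᶠ x in atTop, P.aStar V x = 0) ∧
    (P.A < P.q m → ∀ᶠ x in atTop, P.aStar V x = P.A) ∧
    (0 < P.q m → P.q m < P.A →
      (fun x => P.aStar V x -
          (P.q m - (1 - P.lam / P.r) * ((P.μ - P.r) * m ^ 2 / P.σ ^ 2) * (1 / x)))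
        =o[atTop] (fun x => 1 / x)) := by
  have hD2 := hV.eventually_D2_neg (inv_pos.2 hm)
  have hlim := hV.tendsto_aCrit hm
  refine ⟨?_, ?_, ?_, ?_, ?_⟩
  · filter_upwards [hD2] with x hx
    exact ⟨P.aStar_mem V x, fun a ha hne => RiskModel.gen_lt_gen_aStar _ hx ha hne⟩
  · intro h0 h1
    refine IsBigO.trans (IsBigO.of_bound 1 ?_) (hV.aCrit_sub_isBigO hm)
    filter_upwards [hD2] with x hx
    rw [one_mul]
    exact RiskModel.abs_aStar_sub_le hx ⟨h0, h1⟩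
  · intro hq
    filter_upwards [hD2, hlim.eventually_lt_const hq] with x hx h
    exact RiskModel.aStar_eq_zero hx h.le
  · intro hq
    filter_upwards [hD2, hlim.eventually_const_lt hq] with x hx h
    exact RiskModel.aStar_eq_A hx h.le
  · intro h0 h1
    have h := (hV.tendsto_mul_aCrit_sub hm).sub_const
      ((P.lam / P.r - 1) * ((P.μ - P.r) * m ^ 2 / P.σ ^ 2))
    rw [sub_self, ← isLittleO_one_iff ℝ] at h
    refine (h.mul_isBigO (isBigO_refl (fun x : ℝ => 1 / x) atTop)).congr' ?_ (by simp)
    filter_upwards [hD2, hlim.eventually_const_lt h0, hlim.eventually_lt_const h1,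
      eventually_gt_atTop 0] with x hx ha hb hx0
    rw [RiskModel.aStar_eq_aCrit hx ha hb, sub_mul, mul_comm x, mul_assoc, mul_one_div_cancel hx0.ne']
    ring
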